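/- Let $N\ge 1$ and $0\le M\le N$ be integers, let $x_k=2k/N-1$ $(0\le k\le N)$ be the equally spaced points on $[-1,1]$, and let $\mathbf T_M$ be the $(N+1)\times(M+1)$ matrix with entries $T_j(x_i)$, $0\le i\le N$, $0\le j\le M$, where $T_j$ is the Chebyshev polynomial of the first kind of degree $j$. Write $\sigma_{M+1}(\mathbf T_M)$ for its $(M+1)$-st largest (that is, smallest) singular value. Let $\rho>1$ and $Q<\infty$, and let $E_\rho$ be the open region enclosed by the ellipse with foci $\pm1$ whose semimajor and semiminor axis lengths sum to $\rho$. Let $f:[-1,1]\to\mathbb C$ have an analytic continuation to $E_\rho$ that is bounded there by $Q$ in absolute value. Let $s\ge 0$ and let $\varepsilon_0,\dots,\varepsilon_N$ be independent real random variables with distribution $\mathcal N(0,s^2)$. For all data $y\in\mathbb C^{N+1}$ there is exactly one complex polynomial $p$ of degree at most $M$ that minimizes $\sum_{k=0}^N|y_k-p(x_k)|^2$ among all such polynomials. Let $p_M$ be this (random) least squares fit for the data $y_k=f(x_k)+\varepsilon_k$, and let $\|f-p_M\|_\infty=\sup_{x\in[-1,1]}|f(x)-p_M(x)|$. Then $\|f-p_M\|_\infty$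 is integrable and $$\mathbb E\big[\|f-p_M\|_\infty\big]\le \frac{(M+1)^{3/2}\,s}{\sigma_{M+1}(\mathbf T_M)}+2Q\left[1+\frac{(M+1)(N+1)^{1/2}}{\sigma_{M+1}(\mathbf T_M)}\right]\frac{\rho^{-M}}{\rho-1}.$$ Moreover, if $M\le\tfrac12\sqrt N$, then $$\mathbb E\big[\|f-p_M\|_\infty\big]\le \frac{5\sqrt5\,(M+1)^2 s}{N^{1/2}}+2Q\left[1+10\sqrt5\,(M+1)^{3/2}\right]\frac{\rho^{-M}}{\rho-1}.$$ -/

import Mathlib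

open MeasureTheory ProbabilityTheory
open scoped Polynomial NNReal

noncomputable section

namespace EquispacedLeastSquares

/-- The open Bernstein ellipse `E_ρ`: foci at `±1`, semi-axes `(ρ + ρ⁻¹) / 2` and `(ρ - ρ⁻¹) / 2`
(their sum is `ρ`).  It consists of the points whose distances to the foci add up to less than the
length `ρ + ρ⁻¹` of the major axis. -/
def bernsteinEllipse (ρ : ℝ) : Set ℂ :=
  {z : ℂ | ‖z - 1‖ + ‖z + 1‖ < ρ + ρ⁻¹}

/-- The class `B_ρ(Q)`: functions on `[-1, 1]` that have an analytic continuation to `E_ρ` which is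
bounded there by `Q` in absolute value.  Only the values of `f` on `[-1, 1]` matter. -/
def BernsteinClass (ρ Q : ℝ) : Set (ℝ → ℂ) :=
  {f | ∃ F : ℂ → ℂ, AnalyticOnNhd ℂ F (bernsteinEllipse ρ) ∧
    (∀ z ∈ bernsteinEllipse ρ, ‖F z‖ ≤ Q) ∧
    ∀ x ∈ Set.Icc (-1 : ℝ) 1, f x = F (x : ℂ)}

/-- The equally spaced points `x_k = 2 k / N - 1`, `0 ≤ k ≤ N`. -/
def equiPoint (N : ℕ) (k : Fin (N + 1)) : ℝ :=
  2 * (k : ℝ) / (N : ℝ) - 1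

/-- The `(N + 1) × (M + 1)` Chebyshev-Vandermonde matrix with entries `T_j (x_i)`. -/
def chebVandermonde (N M : ℕ) : Matrix (Fin (N + 1)) (Fin (M + 1)) ℝ :=
  Matrix.of fun i j => (Polynomial.Chebyshev.T ℝ ((j : ℕ) : ℤ)).eval (equiPoint N i)

/-- The `k`-th largest singular value `σ_k(A)`, `k = 1, 2, …`
(Mathlib numbers singular values from `0`). -/
def matrixSingularValue {m n : ℕ} (A : Matrix (Fin m) (Fin n) ℝ) (k : ℕ) : ℝ :=
  (Matrix.toEuclideanLin A).singularValues (k - 1)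

/-- The Euclidean norm of the residual `y - p(x)` on the equally spaced grid. -/
def residualNorm (N : ℕ) (y : Fin (N + 1) → ℂ) (p : ℂ[X]) : ℝ :=
  ‖WithLp.toLp 2 (fun k => y k - p.eval (equiPoint N k : ℂ))‖

/-- `p` is a least squares polynomial fit of degree (at most) `M` to the data `y` on the grid. -/
def IsLeastSquaresFit (N M : ℕ) (y : Fin (N + 1) → ℂ) (p : ℂ[X]) : Prop :=
  p ∈ Polynomial.degreeLE ℂ (M : WithBot ℕ) ∧
    ∀ q ∈ Polynomial.degreeLE ℂ (M : WithBot ℕ), residualNorm N y p ≤ residualNorm N y q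

/-- The uniform error `‖f - p‖_∞ = sup_{x ∈ [-1, 1]} |f x - p x|`.  The supremum is over a bounded
set for every `f` that is bounded on `[-1, 1]`. -/
def uniformError (f : ℝ → ℂ) (p : ℂ[X]) : ℝ :=
  ⨆ x : Set.Icc (-1 : ℝ) 1, ‖f (x : ℝ) - p.eval ((x : ℝ) : ℂ)‖

end EquispacedLeastSquares

end

noncomputable section

namespace EquispacedLeastSquares

/-! The fit is linear in the data: with $A$ the map from Chebyshev coefficients to grid values, the
coefficients of the fit are $A^+y$, where $A^+$ is the orthogonal projection onto the range of $A$
followed by a left inverse of $A$. Hence $\|A^+\|\le 1/\sigma$ (`norm_fitCoeff_le`). Since $|T_j|\le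
1$ on $[-1,1]$, a coefficient perturbation changes the uniform error by at most its $\ell^1$ norm
(`uniformError_chebPoly_le_add`), so noise and truncation can be estimated separately.

Noise: each coefficient of $A^+\varepsilon$ is a Gaussian combination with weights a row of $A^+$.
Such a row has norm at most $1/\sigma$, so the mean modulus is at most $s/\sigma$; there are $M+1$
coefficients.

Truncation: on the unit circle, $f\circ$ Joukowski has Laurent coefficients of size at most
$Q\rho^{-|k|}$, so cutting the Chebyshev series at degree $M$ leaves an error of at most
$2Q\rho^{-M}/(\rho-1)$ (`exists_norm_sub_eval_le`). The fit reproduces polynomials of degree at most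
$M$, so it only acts on this remainder, at a cost of $\sqrt{M+1}\sqrt{N+1}/\sigma$.

If $4M^2\le N$, Markov's inequality keeps a polynomial large at many grid points around its maximum,
while orthogonality of the $T_j$ bounds its coefficients by that maximum. Together these give
$\sigma\ge\sqrt N/(5\sqrt5(M+1))$ (`sqrt_div_le_sigmaMin`). -/

/-! ### Smallest singular value as a minimal stretching factor -/

theorem singularValue_mul_norm_le {E F : Type*} [NormedAddCommGroup E] [InnerProductSpace ℝ E]
    [FiniteDimensional ℝ E] [NormedAddCommGroup F] [InnerProductSpace ℝ F] [FiniteDimensional ℝ F]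
    (T : E →ₗ[ℝ] F) {n : ℕ} (hn : Module.finrank ℝ E = n + 1) (x : E) :
    T.singularValues n * ‖x‖ ≤ ‖T x‖ := by
  have hS := T.isSymmetric_adjoint_comp_self
  -- Parseval in an eigenbasis of $T^*T$. In dimension $n+1$ the index $n$, counted from zero,
  -- belongs to the smallest eigenvalue.
  have h1 : ‖T x‖ ^ 2 = ∑ i, hS.eigenvalues hn i * (hS.eigenvectorBasis hn).repr x i ^ 2 := by
    rw [← real_inner_self_eq_norm_sq, ← LinearMap.adjoint_inner_left,
      ← (hS.eigenvectorBasis hn).repr.inner_map_map, PiLp.inner_apply]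
    refine Finset.sum_congr rfl fun i _ => ?_
    have := hS.eigenvectorBasis_apply_self_apply hn x i
    simp only [LinearMap.comp_apply] at this
    rw [this]
    simp
    ring
  have h2 : (T.singularValues n * ‖x‖) ^ 2 ≤ ‖T x‖ ^ 2 := by
    rw [h1, mul_pow, ← (hS.eigenvectorBasis hn).repr.norm_map x, EuclideanSpace.real_norm_sq_eq,
      Finset.mul_sum]
    refine Finset.sum_le_sum fun i _ => mul_le_mul_of_nonneg_right ?_ (sq_nonneg _)
    rw [T.sq_singularValues_of_lt hn (Nat.lt_succ_self n)]
    exact hS.eigenvalues_antitone hn (Nat.lt_succ_iff.mp i.2)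
  exact (sq_le_sq₀ (mul_nonneg (T.singularValues_nonneg n) (norm_nonneg _)) (norm_nonneg _)).mp h2

/-- Evaluated at this vector, any lower bound on $\|Tv\|/\|v\|$ becomes a lower bound on the
singular value. -/
theorem exists_norm_eq_singularValue_mul_norm {E F : Type*} [NormedAddCommGroup E]
    [InnerProductSpace ℝ E] [FiniteDimensional ℝ E] [NormedAddCommGroup F] [InnerProductSpace ℝ F]
    [FiniteDimensional ℝ F] (T : E →ₗ[ℝ] F) {n : ℕ} (hn : n < Module.finrank ℝ E) :
    ∃ v : E, v ≠ 0 ∧ ‖T v‖ = T.singularValues n * ‖v‖ := by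
  obtain ⟨v, hv⟩ := (T.hasEigenvalue_adjoint_comp_self_sq_singularValues hn).exists_hasEigenvector
  refine ⟨v, hv.2, ?_⟩
  rw [← sq_eq_sq₀ (norm_nonneg _) (mul_nonneg (T.singularValues_nonneg n) (norm_nonneg _)),
    ← real_inner_self_eq_norm_sq, ← LinearMap.adjoint_inner_left]
  have := hv.apply_eq_smul
  simp only [LinearMap.comp_apply] at this
  rw [this, real_inner_smul_left, real_inner_self_eq_norm_sq, mul_pow]
  simp

/-! ### Chebyshev coefficients and grid values -/

/-- The polynomial with given Chebyshev coefficients. -/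
def chebPoly (M : ℕ) : EuclideanSpace ℂ (Fin (M + 1)) →ₗ[ℂ] ℂ[X] where
  toFun c := ∑ j, c j • Polynomial.Chebyshev.T ℂ ((j : ℕ) : ℤ)
  map_add' c d := by simp [add_smul, Finset.sum_add_distrib]
  map_smul' a c := by simp [mul_smul, Finset.smul_sum]

/-- Evaluation of a polynomial on the equally spaced grid. -/
def gridEval (N : ℕ) : ℂ[X] →ₗ[ℂ] EuclideanSpace ℂ (Fin (N + 1)) where
  toFun p := WithLp.toLp 2 fun k => p.eval (equiPoint N k : ℂ)
  map_add' p q := by ext; simp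
  map_smul' a p := by ext; simp

theorem gridEval_apply (N : ℕ) (p : ℂ[X]) (k : Fin (N + 1)) :
    gridEval N p k = p.eval (equiPoint N k : ℂ) := rfl

theorem chebPoly_eval (M : ℕ) (c : EuclideanSpace ℂ (Fin (M + 1))) (x : ℂ) :
    (chebPoly M c).eval x = ∑ j, c j * (Polynomial.Chebyshev.T ℂ ((j : ℕ) : ℤ)).eval x := by
  simp [chebPoly, Polynomial.eval_finsetSum]

theorem range_chebPoly (M : ℕ) :
    LinearMap.range (chebPoly M) = Polynomial.degreeLE ℂ (M : WithBot ℕ) := by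
  have h := Polynomial.Sequence.span_degreeLT (Polynomial.Chebyshev.chebyshevTsequence ℂ)
    (m := M + 1) (by
      intro i _
      exact (Polynomial.leadingCoeff_ne_zero.mpr (Polynomial.Chebyshev.T_ne_zero ℂ _)).isUnit)
  have h2 : Polynomial.degreeLE ℂ (M : WithBot ℕ) = Polynomial.degreeLT ℂ (M + 1) := by
    ext p
    rw [Polynomial.mem_degreeLE, Polynomial.mem_degreeLT]
    by_cases hp : p = 0
    · simp [hp]
    · rw [Polynomial.degree_eq_natDegree hp]
      norm_cast
      exact Nat.lt_succ_iff.symm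
  rw [h2, ← h]
  apply le_antisymm
  · rintro _ ⟨c, rfl⟩
    change ∑ j, c j • Polynomial.Chebyshev.T ℂ ((j : ℕ) : ℤ) ∈ _
    exact Submodule.sum_mem _ fun j _ => Submodule.smul_mem _ _
      (Submodule.subset_span (Set.mem_image_of_mem _ (Set.mem_Iio.mpr j.2)))
  · rw [Submodule.span_le]
    rintro _ ⟨i, hi, rfl⟩
    refine ⟨EuclideanSpace.single ⟨i, hi⟩ 1, ?_⟩
    simp [chebPoly, Polynomial.Chebyshev.chebyshevTsequence]

theorem chebPoly_injective (M : ℕ) : Function.Injective (chebPoly M) := by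
  rw [injective_iff_map_eq_zero]
  intro c hc
  have h := (Polynomial.Sequence.linearIndependent
    (Polynomial.Chebyshev.chebyshevTsequence ℂ)).comp (fun j : Fin (M + 1) => (j : ℕ))
    Fin.val_injective
  rw [Fintype.linearIndependent_iff] at h
  ext j
  exact h c hc j

theorem equiPoint_injective {N : ℕ} (hN : 1 ≤ N) : Function.Injective (equiPoint N) := by
  intro i j h
  have : (N : ℝ) ≠ 0 := by positivity
  unfold equiPoint at h
  field_simp at h
  exact Fin.ext (by exact_mod_cast (by linarith : ((i : ℕ) : ℝ) = j))

theorem equiPoint_mem_Icc (N : ℕ) (k : Fin (N + 1)) : equiPoint N k ∈ Set.Icc (-1 : ℝ) 1 := by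
  have hk : ((k : ℕ) : ℝ) ≤ N := by exact_mod_cast Nat.lt_succ_iff.mp k.2
  rcases Nat.eq_zero_or_pos N with rfl | hN
  · simp [equiPoint]
  have : (0 : ℝ) < N := by exact_mod_cast hN
  constructor
  · have : (0 : ℝ) ≤ 2 * (k : ℕ) / (N : ℝ) := by positivity
    unfold equiPoint; linarith
  · have : 2 * ((k : ℕ) : ℝ) / (N : ℝ) ≤ 2 := by rw [div_le_iff₀ this]; linarith
    unfold equiPoint; linarith

theorem eq_zero_of_gridEval_eq_zero {N M : ℕ} (hN : 1 ≤ N) (hMN : M ≤ N) {p : ℂ[X]}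
    (hp : p ∈ Polynomial.degreeLE ℂ (M : WithBot ℕ)) (h : gridEval N p = 0) : p = 0 := by
  refine Polynomial.eq_zero_of_degree_lt_of_eval_index_eq_zero
    (v := fun k : Fin (N + 1) => (equiPoint N k : ℂ)) (Finset.univ)
    (fun i _ j _ hij => equiPoint_injective hN (Complex.ofReal_injective hij)) ?_ ?_
  · rw [Polynomial.mem_degreeLE] at hp
    refine hp.trans_lt ?_
    rw [Finset.card_univ, Fintype.card_fin]
    exact_mod_cast Nat.lt_succ_of_le hMN
  · intro k _
    have := congrArg (fun v : EuclideanSpace ℂ (Fin (N + 1)) => v k) h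
    simpa [gridEval_apply] using this

/-- The map from Chebyshev coefficients to grid values. -/
def chebGrid (N M : ℕ) : EuclideanSpace ℂ (Fin (M + 1)) →ₗ[ℂ] EuclideanSpace ℂ (Fin (N + 1)) :=
  gridEval N ∘ₗ chebPoly M

theorem chebGrid_injective {N M : ℕ} (hN : 1 ≤ N) (hMN : M ≤ N) :
    Function.Injective (chebGrid N M) := by
  rw [injective_iff_map_eq_zero]
  intro c hc
  have := eq_zero_of_gridEval_eq_zero hN hMN
    (p := chebPoly M c) (by rw [← range_chebPoly]; exact ⟨c, rfl⟩) hc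
  exact chebPoly_injective M (by simpa using this)

theorem toEuclideanLin_chebVandermonde_apply (N M : ℕ) (c : EuclideanSpace ℝ (Fin (M + 1)))
    (i : Fin (N + 1)) : Matrix.toEuclideanLin (chebVandermonde N M) c i =
      ∑ j, c j * (Polynomial.Chebyshev.T ℝ ((j : ℕ) : ℤ)).eval (equiPoint N i) := by
  simp [Matrix.toLpLin_apply, Matrix.mulVec, dotProduct, chebVandermonde, mul_comm]

theorem chebGrid_apply (N M : ℕ) (c : EuclideanSpace ℂ (Fin (M + 1))) (i : Fin (N + 1)) :
    chebGrid N M c i =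
      ∑ j, c j * ((Polynomial.Chebyshev.T ℝ ((j : ℕ) : ℤ)).eval (equiPoint N i) : ℝ) := by
  simp [chebGrid, gridEval_apply, chebPoly_eval]

/-- The smallest singular value of the Chebyshev-Vandermonde matrix. -/
abbrev sigmaMin (N M : ℕ) : ℝ := matrixSingularValue (chebVandermonde N M) (M + 1)

/-- The matrix is real, so it acts separately on real and imaginary parts, and the squared norms
add. -/
theorem sigmaMin_mul_norm_le (N M : ℕ) (c : EuclideanSpace ℂ (Fin (M + 1))) :
    sigmaMin N M * ‖c‖ ≤ ‖chebGrid N M c‖ := by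
  have hs : 0 ≤ sigmaMin N M := LinearMap.singularValues_nonneg _ _
  have key := fun d => singularValue_mul_norm_le (Matrix.toEuclideanLin (chebVandermonde N M))
    (n := M) (by simp) d
  have key2 : ∀ d, (sigmaMin N M) ^ 2 * ‖d‖ ^ 2 ≤
      ‖Matrix.toEuclideanLin (chebVandermonde N M) d‖ ^ 2 := fun d => by
    rw [← mul_pow]
    exact pow_le_pow_left₀ (mul_nonneg hs (norm_nonneg _)) (key d) 2
  set re : EuclideanSpace ℝ (Fin (M + 1)) := WithLp.toLp 2 fun j => (c j).re with hre
  set im : EuclideanSpace ℝ (Fin (M + 1)) := WithLp.toLp 2 fun j => (c j).im with him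
  have h1 : ‖c‖ ^ 2 = ‖re‖ ^ 2 + ‖im‖ ^ 2 := by
    rw [EuclideanSpace.norm_sq_eq, EuclideanSpace.real_norm_sq_eq, EuclideanSpace.real_norm_sq_eq,
      ← Finset.sum_add_distrib]
    refine Finset.sum_congr rfl fun j _ => ?_
    rw [Complex.sq_norm, Complex.normSq_apply, hre, him]
    ring
  have h2 : ‖chebGrid N M c‖ ^ 2 = ‖Matrix.toEuclideanLin (chebVandermonde N M) re‖ ^ 2 +
      ‖Matrix.toEuclideanLin (chebVandermonde N M) im‖ ^ 2 := by
    rw [EuclideanSpace.norm_sq_eq, EuclideanSpace.real_norm_sq_eq, EuclideanSpace.real_norm_sq_eq,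
      ← Finset.sum_add_distrib]
    refine Finset.sum_congr rfl fun i _ => ?_
    rw [Complex.sq_norm, Complex.normSq_apply, chebGrid_apply,
      toEuclideanLin_chebVandermonde_apply, toEuclideanLin_chebVandermonde_apply, Complex.re_sum,
      Complex.im_sum]
    simp only [Complex.re_mul_ofReal, Complex.im_mul_ofReal, hre, him]
    ring
  refine le_of_sq_le_sq ?_ (norm_nonneg _)
  rw [mul_pow, h1, h2, mul_add]
  exact add_le_add (key2 re) (key2 im)

theorem exists_norm_eq_sigmaMin_mul (N M : ℕ) : ∃ v : EuclideanSpace ℝ (Fin (M + 1)), v ≠ 0 ∧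
    ‖Matrix.toEuclideanLin (chebVandermonde N M) v‖ = sigmaMin N M * ‖v‖ :=
  exists_norm_eq_singularValue_mul_norm (Matrix.toEuclideanLin (chebVandermonde N M)) (n := M)
    (by simp)

theorem sigmaMin_pos {N M : ℕ} (hN : 1 ≤ N) (hMN : M ≤ N) : 0 < sigmaMin N M := by
  refine lt_of_le_of_ne (LinearMap.singularValues_nonneg _ _) fun h => ?_
  obtain ⟨v, hv, h1⟩ := exists_norm_eq_sigmaMin_mul N M
  rw [← h, zero_mul, norm_eq_zero] at h1
  apply hv
  have h2 : chebGrid N M (WithLp.toLp 2 fun j => (v j : ℂ)) = 0 := by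
    ext i
    have := congrArg (fun w : EuclideanSpace ℝ (Fin (N + 1)) => ((w i : ℝ) : ℂ)) h1
    simp only [toEuclideanLin_chebVandermonde_apply] at this
    rw [chebGrid_apply]
    simpa using this
  have h3 := chebGrid_injective hN hMN (h2.trans (map_zero _).symm)
  ext j
  have := congrArg (fun w : EuclideanSpace ℂ (Fin (M + 1)) => w j) h3
  simpa using this

theorem norm_chebPoly_eval_le (M : ℕ) (c : EuclideanSpace ℂ (Fin (M + 1))) {x : ℝ}
    (hx : x ∈ Set.Icc (-1 : ℝ) 1) : ‖(chebPoly M c).eval (x : ℂ)‖ ≤ ∑ j, ‖c j‖ := by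
  rw [chebPoly_eval]
  refine (norm_sum_le _ _).trans (Finset.sum_le_sum fun j _ => ?_)
  rw [norm_mul, ← Polynomial.Chebyshev.complex_ofReal_eval_T, Complex.norm_real, Real.norm_eq_abs]
  exact mul_le_of_le_one_right (norm_nonneg _)
    (Polynomial.Chebyshev.abs_eval_T_real_le_one _ (abs_le.mpr hx))

theorem sum_norm_le_sqrt_mul_norm {n : ℕ} (c : EuclideanSpace ℂ (Fin n)) :
    ∑ j, ‖c j‖ ≤ √n * ‖c‖ := by
  rw [EuclideanSpace.norm_eq, ← Real.sqrt_mul (Nat.cast_nonneg n)]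
  refine Real.le_sqrt_of_sq_le ?_
  simpa using sq_sum_le_card_mul_sum_sq (s := Finset.univ) (f := fun j => ‖c j‖)

/-! ### The least squares operator -/

/-- The least squares solution operator, from data to Chebyshev coefficients. -/
def fitCoeff (N M : ℕ) : EuclideanSpace ℂ (Fin (N + 1)) →ₗ[ℂ] EuclideanSpace ℂ (Fin (M + 1)) :=
  (chebGrid N M).leftInverse ∘ₗ (LinearMap.range (chebGrid N M)).starProjection.toLinearMap

theorem leftInverse_chebGrid {N M : ℕ} (hN : 1 ≤ N) (hMN : M ≤ N)
    (c : EuclideanSpace ℂ (Fin (M + 1))) :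
    (chebGrid N M).leftInverse (chebGrid N M c) = c :=
  LinearMap.leftInverse_apply_of_inj (LinearMap.ker_eq_bot.mpr (chebGrid_injective hN hMN)) c

theorem chebGrid_fitCoeff {N M : ℕ} (hN : 1 ≤ N) (hMN : M ≤ N)
    (y : EuclideanSpace ℂ (Fin (N + 1))) :
    chebGrid N M (fitCoeff N M y) = (LinearMap.range (chebGrid N M)).starProjection y := by
  obtain ⟨c, hc⟩ : (LinearMap.range (chebGrid N M)).starProjection y ∈
    LinearMap.range (chebGrid N M) := Submodule.starProjection_apply_mem _ _
  simp only [fitCoeff, LinearMap.comp_apply, ContinuousLinearMap.coe_coe]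
  rw [← hc, leftInverse_chebGrid hN hMN]

theorem fitCoeff_chebGrid {N M : ℕ} (hN : 1 ≤ N) (hMN : M ≤ N)
    (c : EuclideanSpace ℂ (Fin (M + 1))) :
    fitCoeff N M (chebGrid N M c) = c := by
  simp only [fitCoeff, LinearMap.comp_apply, ContinuousLinearMap.coe_coe]
  rw [Submodule.starProjection_eq_self_iff.mpr (LinearMap.mem_range_self _ c), leftInverse_chebGrid hN hMN]

theorem norm_fitCoeff_le {N M : ℕ} (hN : 1 ≤ N) (hMN : M ≤ N)
    (y : EuclideanSpace ℂ (Fin (N + 1))) :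
    ‖fitCoeff N M y‖ ≤ ‖y‖ / sigmaMin N M := by
  rw [le_div_iff₀' (sigmaMin_pos hN hMN)]
  refine (sigmaMin_mul_norm_le N M _).trans ?_
  rw [chebGrid_fitCoeff hN hMN]
  exact Submodule.norm_starProjection_apply_le _ _

/-- By Pythagoras the squared residual is a constant plus the squared distance from the grid values
to the projection of the data. The minimum is attained exactly at the projection, and injectivity of
`chebGrid` gives uniqueness. -/
theorem isLeastSquaresFit_iff {N M : ℕ} (hN : 1 ≤ N) (hMN : M ≤ N)
    (y : Fin (N + 1) → ℂ) (p : ℂ[X]) :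
    IsLeastSquaresFit N M y p ↔ p = chebPoly M (fitCoeff N M (WithLp.toLp 2 y)) := by
  set Y : EuclideanSpace ℂ (Fin (N + 1)) := WithLp.toLp 2 y with hY
  set U := LinearMap.range (chebGrid N M)
  have hres : ∀ c, residualNorm N y (chebPoly M c) ^ 2 =
      ‖chebGrid N M c - U.starProjection Y‖ ^ 2 + ‖Y - U.starProjection Y‖ ^ 2 := by
    intro c
    have h0 : residualNorm N y (chebPoly M c) = ‖Y - chebGrid N M c‖ := rfl
    have h1 : Y - chebGrid N M c =
      (U.starProjection Y - chebGrid N M c) + (Y - U.starProjection Y) := by abel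
    rw [h0, h1, norm_sub_rev (chebGrid N M c), sq, sq, sq]
    refine norm_add_sq_eq_norm_sq_add_norm_sq_of_inner_eq_zero (𝕜 := ℂ) _ _ ?_
    exact Submodule.inner_right_of_mem_orthogonal (K := U)
      (U.sub_mem (Submodule.starProjection_apply_mem _ _) ⟨c, rfl⟩)
      (Submodule.sub_starProjection_mem_orthogonal _)
  have hmin : residualNorm N y (chebPoly M (fitCoeff N M Y)) ^ 2 =
      ‖Y - U.starProjection Y‖ ^ 2 := by
    rw [hres, chebGrid_fitCoeff hN hMN]
    simp [U]
  unfold IsLeastSquaresFit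
  rw [← range_chebPoly]
  constructor
  · rintro ⟨⟨c, rfl⟩, h⟩
    have h1 := pow_le_pow_left₀ (norm_nonneg _) (h _ ⟨fitCoeff N M Y, rfl⟩) 2
    change residualNorm _ _ _ ^ 2 ≤ _ at h1
    rw [hmin, hres] at h1
    have h2 : ‖chebGrid N M c - U.starProjection Y‖ ^ 2 = 0 :=
      le_antisymm (by linarith) (sq_nonneg _)
    have h3 : chebGrid N M c = U.starProjection Y := by
      simpa [sub_eq_zero] using h2
    rw [← chebGrid_fitCoeff hN hMN] at h3
    rw [chebGrid_injective hN hMN h3]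
  · rintro rfl
    refine ⟨⟨_, rfl⟩, ?_⟩
    rintro _ ⟨c, rfl⟩
    refine le_of_sq_le_sq ?_ (norm_nonneg _)
    rw [hmin, hres]
    linarith [sq_nonneg ‖chebGrid N M c - U.starProjection Y‖]

/-! ### Moments of Gaussian sums -/

section gaussian

variable {Ω : Type*} [MeasurableSpace Ω] {P : Measure Ω}

theorem memLp_two_of_hasLaw_gaussian {X : Ω → ℝ} {v : ℝ≥0} (hX : HasLaw X (gaussianReal 0 v) P) :
    MemLp X 2 P := by
  have h := memLp_id_gaussianReal' (μ := 0) (v := v) 2 (by simp)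
  rw [← hX.map_eq] at h
  exact h.comp_of_map hX.aemeasurable

theorem integral_sq_sum_gaussian [IsProbabilityMeasure P] {ι : Type*} [Fintype ι] {s : ℝ≥0} {ε : ι → Ω → ℝ}
    (hlaw : ∀ k, HasLaw (ε k) (gaussianReal 0 (s ^ 2)) P) (hindep : iIndepFun ε P) (a : ι → ℝ) :
    Integrable (fun ω => (∑ k, ε k ω * a k) ^ 2) P ∧
      ∫ ω, (∑ k, ε k ω * a k) ^ 2 ∂P = (s : ℝ) ^ 2 * ∑ k, a k ^ 2 := by
  have hL : ∀ k, MemLp (fun ω => ε k ω * a k) 2 P := fun k =>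
    (memLp_two_of_hasLaw_gaussian (hlaw k)).mul_const (a k)
  have hsum : MemLp (∑ k, fun ω => ε k ω * a k) 2 P := memLp_finsetSum' _ fun k _ => hL k
  have hfun : (fun ω => (∑ k, ε k ω * a k) ^ 2) = (∑ k, fun ω => ε k ω * a k) ^ 2 := by
    ext ω; simp
  refine ⟨by rw [hfun]; exact hsum.integrable_sq, ?_⟩
  have hmean : ∀ k, ∫ ω, ε k ω * a k ∂P = 0 := fun k => by
    rw [integral_mul_const, (hlaw k).integral_eq]
    simp
  have hmean' : P[∑ k, fun ω => ε k ω * a k] = 0 := by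
    simp only [Finset.sum_apply]
    rw [integral_finsetSum _ fun k _ => (hL k).integrable (by norm_num)]
    simp [hmean]
  have hvar := IndepFun.variance_sum (μ := P) (s := Finset.univ)
    (X := fun k ω => ε k ω * a k) (fun k _ => hL k) (fun i _ j _ hij =>
      (hindep.indepFun hij).comp (φ := fun x => x * a i) (ψ := fun x => x * a j)
        (by fun_prop) (by fun_prop))
  rw [variance_eq_sub hsum, hmean'] at hvar
  rw [hfun]
  simp only [ne_eq, OfNat.ofNat_ne_zero, not_false_eq_true, zero_pow, sub_zero] at hvar
  rw [hvar, Finset.mul_sum]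
  refine Finset.sum_congr rfl fun k _ => ?_
  rw [variance_mul_const, (hlaw k).variance_eq]
  have : Var[id; gaussianReal 0 (s ^ 2)] = ((s ^ 2 : ℝ≥0) : ℝ) := variance_id_gaussianReal
  rw [this]
  push_cast
  ring

/-- Real and imaginary parts are real Gaussian sums with known second moments. Nonnegativity of the
variance then bounds the first moment by the root of the second. -/
theorem integral_norm_sum_gaussian_le [IsProbabilityMeasure P] {ι : Type*} [Fintype ι] {s : ℝ≥0} {ε : ι → Ω → ℝ}
    (hlaw : ∀ k, HasLaw (ε k) (gaussianReal 0 (s ^ 2)) P) (hindep : iIndepFun ε P) (a : ι → ℂ) :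
    Integrable (fun ω => ‖∑ k, (ε k ω : ℂ) * a k‖) P ∧
      ∫ ω, ‖∑ k, (ε k ω : ℂ) * a k‖ ∂P ≤ s * √(∑ k, ‖a k‖ ^ 2) := by
  have hm : AEStronglyMeasurable (fun ω => ‖∑ k, (ε k ω : ℂ) * a k‖) P := by
    have := fun k => (hlaw k).aemeasurable
    refine AEMeasurable.aestronglyMeasurable ?_
    refine AEMeasurable.norm (Finset.aemeasurable_fun_sum _ fun k _ => ?_)
    exact (Complex.measurable_ofReal.comp_aemeasurable (this k)).mul_const _
  obtain ⟨hr, hr'⟩ := integral_sq_sum_gaussian hlaw hindep fun k => (a k).re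
  obtain ⟨hi, hi'⟩ := integral_sq_sum_gaussian hlaw hindep fun k => (a k).im
  have hsq : (fun ω => ‖∑ k, (ε k ω : ℂ) * a k‖ ^ 2) = fun ω =>
      (∑ k, ε k ω * (a k).re) ^ 2 + (∑ k, ε k ω * (a k).im) ^ 2 := by
    ext ω
    rw [Complex.sq_norm, Complex.normSq_apply, Complex.re_sum, Complex.im_sum]
    simp only [Complex.re_ofReal_mul, Complex.im_ofReal_mul]
    ring
  have hL : MemLp (fun ω => ‖∑ k, (ε k ω : ℂ) * a k‖) 2 P := by
    rw [memLp_two_iff_integrable_sq hm, hsq]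
    exact hr.add hi
  refine ⟨hL.integrable (by norm_num), ?_⟩
  have h1 : (∫ ω, ‖∑ k, (ε k ω : ℂ) * a k‖ ∂P) ^ 2 ≤ s ^ 2 * ∑ k, ‖a k‖ ^ 2 := by
    have h2 := variance_nonneg (fun ω => ‖∑ k, (ε k ω : ℂ) * a k‖) P
    rw [variance_eq_sub hL] at h2
    refine (sub_nonneg.mp h2).trans (le_of_eq ?_)
    change ∫ ω, ‖∑ k, (ε k ω : ℂ) * a k‖ ^ 2 ∂P = _
    rw [hsq, integral_add hr hi, hr', hi', ← mul_add, ← Finset.sum_add_distrib]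
    congr 1
    refine Finset.sum_congr rfl fun k _ => ?_
    rw [Complex.sq_norm, Complex.normSq_apply]
    ring
  refine le_of_sq_le_sq (h1.trans (le_of_eq ?_)) (by positivity)
  rw [mul_pow, Real.sq_sqrt (by positivity)]

end gaussian

/-! ### Joukowski map and Bernstein ellipse -/

/-- The Joukowski map. -/
def joukowski (z : ℂ) : ℂ := (z + z⁻¹) / 2

/-- $J(z)\mp1=(z\mp1)^2/(2z)$, so the sum of focal distances is $(|z-1|^2+|z+1|^2)/(2|z|)$, which
the parallelogram law evaluates. -/
theorem norm_joukowski_sub_one_add_norm_joukowski_add_one {z : ℂ} (hz : z ≠ 0) :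
    ‖joukowski z - 1‖ + ‖joukowski z + 1‖ = ‖z‖ + ‖z‖⁻¹ := by
  have h1 : joukowski z - 1 = (z - 1) * (z - 1) / (2 * z) := by
    unfold joukowski; field_simp; ring
  have h2 : joukowski z + 1 = (z + 1) * (z + 1) / (2 * z) := by
    unfold joukowski; field_simp; ring
  have h3 := parallelogram_law_with_norm ℝ z 1
  have h4 : ‖z‖ ≠ 0 := norm_ne_zero_iff.mpr hz
  rw [norm_one] at h3
  rw [h1, h2, norm_div, norm_div, norm_mul, norm_mul, norm_mul, Complex.norm_two]
  field_simp
  linarith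

theorem joukowski_mem_bernsteinEllipse {ρ : ℝ} (hρ : 1 < ρ) {z : ℂ} (h1 : ρ⁻¹ < ‖z‖)
    (h2 : ‖z‖ < ρ) : joukowski z ∈ bernsteinEllipse ρ := by
  have hρ0 : 0 < ρ := by linarith
  have hz : 0 < ‖z‖ := (inv_pos.mpr hρ0).trans h1
  change ‖joukowski z - 1‖ + ‖joukowski z + 1‖ < ρ + ρ⁻¹
  rw [norm_joukowski_sub_one_add_norm_joukowski_add_one (norm_pos_iff.mp hz)]
  have h3 : 1 < ρ * ‖z‖ := by rwa [inv_lt_iff_one_lt_mul₀' hρ0] at h1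
  have h4 : ρ + ρ⁻¹ - (‖z‖ + ‖z‖⁻¹) = (ρ - ‖z‖) * (ρ * ‖z‖ - 1) / (ρ * ‖z‖) := by
    field_simp
    ring
  have : 0 < (ρ - ‖z‖) * (ρ * ‖z‖ - 1) / (ρ * ‖z‖) :=
    div_pos (mul_pos (by linarith) (by linarith)) (by positivity)
  linarith

theorem joukowski_exp (θ : ℝ) : joukowski (Complex.exp (θ * Complex.I)) = (Real.cos θ : ℂ) := by
  rw [joukowski, ← Complex.exp_neg, Complex.ofReal_cos, Complex.cos]
  ring_nf

/-! ### Decay of Chebyshev coefficients and truncation -/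

section laurent

variable {ρ Q : ℝ} {F : ℂ → ℂ}

theorem differentiableAt_comp_joukowski (hρ : 1 < ρ)
    (hF : AnalyticOnNhd ℂ F (bernsteinEllipse ρ)) {z : ℂ} (h1 : ρ⁻¹ < ‖z‖) (h2 : ‖z‖ < ρ) :
    DifferentiableAt ℂ (fun z => F (joukowski z)) z := by
  have hz : z ≠ 0 := norm_pos_iff.mp ((inv_pos.mpr (by linarith)).trans h1)
  have hj : DifferentiableAt ℂ joukowski z := by
    unfold joukowski
    fun_prop (disch := assumption)
  exact ((hF _ (joukowski_mem_bernsteinEllipse hρ h1 h2)).differentiableAt).comp z hj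

/-- The Laurent coefficients of `F ∘ joukowski`, computed on the circle of radius `r`. -/
def laurentCoeff (F : ℂ → ℂ) (k : ℤ) (r : ℝ) : ℂ :=
  (2 * Real.pi * Complex.I)⁻¹ * ∮ z in C(0, r), z ^ (-k - 1) * F (joukowski z)

theorem laurentCoeff_eq_of_le (hρ : 1 < ρ) (hF : AnalyticOnNhd ℂ F (bernsteinEllipse ρ)) (k : ℤ)
    {r R : ℝ} (hr : ρ⁻¹ < r) (hrR : r ≤ R) (hR : R < ρ) :
    laurentCoeff F k R = laurentCoeff F k r := by
  have hr0 : 0 < r := (inv_pos.mpr (by linarith)).trans hr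
  have hd : ∀ z : ℂ, r ≤ ‖z‖ → ‖z‖ ≤ R →
      DifferentiableAt ℂ (fun z => z ^ (-k - 1) * F (joukowski z)) z := fun z h1 h2 =>
    (differentiableAt_zpow.mpr (Or.inl (norm_pos_iff.mp (hr0.trans_le h1)))).mul
      (differentiableAt_comp_joukowski hρ hF (hr.trans_le h1) (h2.trans_lt hR))
  unfold laurentCoeff
  rw [Complex.circleIntegral_eq_of_differentiable_on_annulus_off_countable hr0 hrR
    Set.countable_empty]
  · intro z hz
    refine (hd z ?_ ?_).continuousAt.continuousWithinAt
    · simpa using hz.2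
    · simpa using hz.1
  · intro z hz
    refine hd z ?_ ?_
    · simpa using (not_le.mp (fun h => hz.1.2 (by simpa using h))).le
    · simpa using (Metric.mem_ball.mp hz.1.1).le

theorem norm_laurentCoeff_le (hρ : 1 < ρ) (hF : AnalyticOnNhd ℂ F (bernsteinEllipse ρ))
    (hQ : ∀ z ∈ bernsteinEllipse ρ, ‖F z‖ ≤ Q) (k : ℤ) {r : ℝ} (hr : ρ⁻¹ < r) (hR : r < ρ) :
    ‖laurentCoeff F k 1‖ ≤ Q * r ^ (-k) := by
  have hr0 : 0 < r := (inv_pos.mpr (by linarith)).trans hr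
  have hρ1 : ρ⁻¹ < 1 := inv_lt_one_of_one_lt₀ hρ
  have h1 : laurentCoeff F k 1 = laurentCoeff F k r := by
    rcases le_total r 1 with h | h
    · exact laurentCoeff_eq_of_le hρ hF k hr h hρ
    · exact (laurentCoeff_eq_of_le hρ hF k hρ1 h hR).symm
  rw [h1, laurentCoeff]
  have h2 := circleIntegral.norm_two_pi_i_inv_smul_integral_le_of_norm_le_const (c := 0) hr0.le
    (f := fun z => z ^ (-k - 1) * F (joukowski z)) (C := r ^ (-k - 1) * Q) (by
      intro z hz
      have hz' : ‖z‖ = r := by simpa using hz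
      rw [norm_mul, norm_zpow, hz']
      exact mul_le_mul_of_nonneg_left (hQ _ (joukowski_mem_bernsteinEllipse hρ (by rwa [hz'])
        (by rwa [hz']))) (by positivity))
  refine h2.trans (le_of_eq ?_)
  rw [zpow_sub_one₀ hr0.ne']
  field_simp

/-- Only radii strictly between $\rho^{-1}$ and $\rho$ are available, so the bound comes from the
limit $r\to\rho$ for $k\ge0$ and $r\to\rho^{-1}$ for $k\le0$. -/
theorem norm_laurentCoeff_one_le (hρ : 1 < ρ) (hF : AnalyticOnNhd ℂ F (bernsteinEllipse ρ))
    (hQ : ∀ z ∈ bernsteinEllipse ρ, ‖F z‖ ≤ Q) (k : ℤ) :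
    ‖laurentCoeff F k 1‖ ≤ Q * ρ⁻¹ ^ k.natAbs := by
  have hρ0 : 0 < ρ := by linarith
  have hlt : ρ⁻¹ < ρ := (inv_lt_one_of_one_lt₀ hρ).trans hρ
  have hc : ∀ x : ℝ, x ≠ 0 → ContinuousAt (fun r : ℝ => Q * r ^ (-k)) x := fun x hx =>
    continuousAt_const.mul (continuousAt_zpow₀ x _ (Or.inl hx))
  rcases Int.natAbs_eq k with h | h
  · have h1 : Q * ρ⁻¹ ^ k.natAbs = Q * ρ ^ (-k) := by
      conv_rhs => rw [h]
      rw [zpow_neg, zpow_natCast, inv_pow]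
    rw [h1]
    exact ge_of_tendsto ((hc ρ hρ0.ne').mono_left nhdsWithin_le_nhds)
      (Filter.mem_of_superset (Ioo_mem_nhdsLT hlt)
        fun r hr => norm_laurentCoeff_le hρ hF hQ k hr.1 hr.2)
  · have h1 : Q * ρ⁻¹ ^ k.natAbs = Q * ρ⁻¹ ^ (-k) := by
      conv_rhs => rw [h]
      rw [neg_neg, zpow_natCast]
    rw [h1]
    exact ge_of_tendsto ((hc ρ⁻¹ (inv_ne_zero hρ0.ne')).mono_left nhdsWithin_le_nhds)
      (Filter.mem_of_superset (Ioo_mem_nhdsGT hlt)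
        fun r hr => norm_laurentCoeff_le hρ hF hQ k hr.1 hr.2)

theorem hasSum_ite_natAbs_le (hρ : 1 < ρ) (Q : ℝ) (M : ℕ) :
    HasSum (fun k : ℤ => if k.natAbs ≤ M then 0 else Q * ρ⁻¹ ^ k.natAbs)
      (2 * Q * (ρ ^ (-(M : ℤ)) / (ρ - 1))) := by
  have hρ0 : 0 < ρ := by linarith
  have hρ1 : ρ - 1 ≠ 0 := by linarith
  have hg : HasSum (fun n : ℕ => Q * ρ⁻¹ ^ (n + (M + 1))) (Q * (ρ ^ (-(M : ℤ)) / (ρ - 1))) := by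
    have := ((hasSum_geometric_of_lt_one (inv_nonneg.mpr hρ0.le)
      (inv_lt_one_of_one_lt₀ hρ)).mul_right (ρ⁻¹ ^ (M + 1))).mul_left Q
    convert this using 1
    · rfl
    · ext n; rw [pow_add]
    · rw [zpow_neg, zpow_natCast, pow_succ, inv_pow]
      have h1 : 1 - ρ⁻¹ ≠ 0 := by
        have := inv_lt_one_of_one_lt₀ hρ
        linarith
      field_simp
  have h2 : 2 * Q * (ρ ^ (-(M : ℤ)) / (ρ - 1)) =
      Q * (ρ ^ (-(M : ℤ)) / (ρ - 1)) + Q * (ρ ^ (-(M : ℤ)) / (ρ - 1)) := by ring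
  rw [h2]
  -- The halves are $k=n$ and $k=-(n+1)$; the vanishing terms number $M+1$ in the first and $M$ in
  -- the second, and both leave the same geometric tail.
  refine HasSum.of_nat_of_neg_add_one ?_ ?_
  · rw [← hasSum_nat_add_iff' (M + 1)]
    convert hg using 1
    · rfl
    · ext n
      rw [if_neg (by simp; omega)]
      simp
      left
      norm_cast
    · rw [sub_eq_self]
      refine Finset.sum_eq_zero fun i hi => ?_
      rw [if_pos]
      simpa [Nat.lt_succ_iff] using hi
  · rw [← hasSum_nat_add_iff' M]
    convert hg using 1
    · rfl
    · ext n
      have : (-(((n + M : ℕ) : ℤ) + 1)).natAbs = n + (M + 1) := by omega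
      rw [this, if_neg (by omega)]
    · rw [sub_eq_self]
      refine Finset.sum_eq_zero fun i hi => ?_
      rw [if_pos]
      have := Finset.mem_range.mp hi
      omega

/-- The Laurent coefficients on the unit circle are the Fourier coefficients of $t\mapsto F(\cos
t)$. They are summable, so the Fourier series converges pointwise; averaging it at $\theta$ and
$-\theta$ turns exponentials into cosines. -/
theorem hasSum_laurentCoeff_mul_cos (hρ : 1 < ρ) (hF : AnalyticOnNhd ℂ F (bernsteinEllipse ρ))
    (hQ : ∀ z ∈ bernsteinEllipse ρ, ‖F z‖ ≤ Q) (θ : ℝ) :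
    HasSum (fun k : ℤ => laurentCoeff F k 1 * Complex.cos (k * θ)) (F (Real.cos θ)) := by
  have hρ0 : 0 < ρ := by linarith
  have : Fact (0 < 2 * Real.pi) := ⟨Real.two_pi_pos⟩
  have hper : Function.Periodic (fun t : ℝ => F (Real.cos t)) (2 * Real.pi) := fun t => by
    simp only [Real.cos_add_two_pi]
  have hcont : Continuous (fun t : ℝ => F (Real.cos t)) := by
    refine continuous_iff_continuousAt.mpr fun t => ?_
    have h1 : ‖Complex.exp (t * Complex.I)‖ = 1 := Complex.norm_exp_ofReal_mul_I t
    have hd := (differentiableAt_comp_joukowski hρ hF (z := Complex.exp (t * Complex.I))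
      (by rw [h1]; exact inv_lt_one_of_one_lt₀ hρ) (by rwa [h1])).continuousAt
    have hc : ContinuousAt (fun t : ℝ => Complex.exp (t * Complex.I)) t := by fun_prop
    have := hd.comp_of_eq hc rfl
    refine this.congr (Filter.Eventually.of_forall fun s => ?_)
    simp only [Function.comp_apply, joukowski_exp]
  let G : C(AddCircle (2 * Real.pi), ℂ) := ⟨hper.lift, continuous_coinduced_dom.mpr hcont⟩
  have hG : ∀ t : ℝ, G (t : AddCircle (2 * Real.pi)) = F (Real.cos t) := fun t => rfl
  have hfour : ∀ (n : ℤ) (t : ℝ), fourier n (t : AddCircle (2 * Real.pi)) =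
      Complex.exp (n * t * Complex.I) := fun n t => by
    rw [fourier_coe_apply]
    congr 1
    push_cast
    have := Real.pi_ne_zero
    field_simp
  have hcoef : ∀ k, fourierCoeff G k = laurentCoeff F k 1 := fun k => by
    rw [fourierCoeff_eq_intervalIntegral G k 0, laurentCoeff, circleIntegral, zero_add,
      Complex.real_smul]
    have : ∀ t : ℝ, deriv (circleMap 0 1) t • (circleMap 0 1 t ^ (-k - 1) *
        F (joukowski (circleMap 0 1 t))) = Complex.I * (fourier (-k) (t : AddCircle (2 * Real.pi)) •
          G (t : AddCircle (2 * Real.pi))) := fun t => by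
      have hc : circleMap 0 1 t = Complex.exp (t * Complex.I) := by simp [circleMap]
      rw [deriv_circleMap, hc, joukowski_exp, hG, hfour, smul_eq_mul, smul_eq_mul,
        zpow_sub_one₀ (Complex.exp_ne_zero _), ← Complex.exp_int_mul]
      have := Complex.exp_ne_zero (t * Complex.I)
      push_cast
      field_simp
    simp_rw [this]
    rw [intervalIntegral.integral_const_mul, ← mul_assoc]
    congr 1
    push_cast
    have := Real.pi_ne_zero
    field_simp
  have hsum : Summable (fourierCoeff G) := by
    have h1 : Summable fun k : ℤ => Q * ρ⁻¹ ^ k.natAbs := by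
      have hg := (summable_geometric_of_lt_one (inv_nonneg.mpr hρ0.le)
        (inv_lt_one_of_one_lt₀ hρ)).mul_left Q
      refine Summable.of_nat_of_neg ?_ ?_
      · simpa using hg
      · simpa using hg
    exact Summable.of_norm_bounded h1 fun k => by
      rw [hcoef]; exact norm_laurentCoeff_one_le hρ hF hQ k
  have hp := fun t : ℝ => has_pointwise_sum_fourier_series_of_summable hsum
    (t : AddCircle (2 * Real.pi))
  have h3 := ((hp θ).add (hp (-θ))).div_const 2
  rw [hG, hG, Real.cos_neg, add_self_div_two] at h3
  convert h3 using 1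
  · rfl
  ext k
  rw [hcoef, hfour, hfour, Complex.cos, smul_eq_mul, smul_eq_mul]
  push_cast
  ring_nf

/-- The two-sided cosine series is cut at $|k|\le M$. Keeping negative indices, with $T_{-k}=T_k$,
avoids a special weight for $k=0$. -/
theorem exists_norm_sub_eval_le (hρ : 1 < ρ) {f : ℝ → ℂ} (hf : f ∈ BernsteinClass ρ Q) (M : ℕ) :
    ∃ q ∈ Polynomial.degreeLE ℂ (M : WithBot ℕ), ∀ x ∈ Set.Icc (-1 : ℝ) 1,
      ‖f x - q.eval (x : ℂ)‖ ≤ 2 * Q * (ρ ^ (-(M : ℤ)) / (ρ - 1)) := by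
  obtain ⟨F, hF, hQ, hfF⟩ := hf
  refine ⟨∑ k ∈ Finset.Icc (-(M : ℤ)) M, laurentCoeff F k 1 • Polynomial.Chebyshev.T ℂ k, ?_, ?_⟩
  · refine Submodule.sum_mem _ fun k hk => Submodule.smul_mem _ _ ?_
    rw [Polynomial.mem_degreeLE, Polynomial.Chebyshev.degree_T]
    rw [Finset.mem_Icc] at hk
    exact_mod_cast (by omega : k.natAbs ≤ M)
  · intro x hx
    rw [hfF x hx, ← Real.cos_arccos hx.1 hx.2]
    set θ := Real.arccos x
    have h1 := hasSum_laurentCoeff_mul_cos hρ hF hQ θ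
    have h2 := hasSum_sum_of_ne_finset_zero (L := SummationFilter.unconditional ℤ) (s := Finset.Icc (-(M : ℤ)) M)
      (f := fun k : ℤ => if k.natAbs ≤ M then laurentCoeff F k 1 * Complex.cos (k * θ) else 0)
      fun k hk => if_neg (by rw [Finset.mem_Icc] at hk; omega)
    have h3 := h1.sub h2
    have h4 : ∑ k ∈ Finset.Icc (-(M : ℤ)) M, (if k.natAbs ≤ M then
        laurentCoeff F k 1 * Complex.cos (k * θ) else 0) =
        (∑ k ∈ Finset.Icc (-(M : ℤ)) M, laurentCoeff F k 1 •
          Polynomial.Chebyshev.T ℂ k).eval (Real.cos θ : ℂ) := by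
      rw [Polynomial.eval_finsetSum]
      refine Finset.sum_congr rfl fun k hk => ?_
      rw [Finset.mem_Icc] at hk
      rw [if_pos (by omega), Polynomial.eval_smul, Complex.ofReal_cos,
        Polynomial.Chebyshev.T_complex_cos, smul_eq_mul]
    rw [h4] at h3
    refine h3.norm_le_of_bounded (hasSum_ite_natAbs_le hρ Q M) fun k => ?_
    split_ifs with hk
    · simp
    · rw [sub_zero, norm_mul]
      refine (mul_le_of_le_one_right (norm_nonneg _) ?_).trans
        (norm_laurentCoeff_one_le hρ hF hQ k)
      have : (k : ℂ) * (θ : ℂ) = (((k : ℝ) * θ : ℝ) : ℂ) := by push_cast; ring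
      rw [this, ← Complex.ofReal_cos, Complex.norm_real]
      exact Real.abs_cos_le_one _

theorem bound_nonneg_of_mem_bernsteinClass (hρ : 1 < ρ) {f : ℝ → ℂ} (hf : f ∈ BernsteinClass ρ Q) :
    0 ≤ Q := by
  obtain ⟨F, -, hQ, -⟩ := hf
  have h : joukowski 1 ∈ bernsteinEllipse ρ := joukowski_mem_bernsteinEllipse hρ
    (by simpa using inv_lt_one_of_one_lt₀ hρ) (by simpa using hρ)
  exact (norm_nonneg _).trans (hQ _ h)

end laurent

/-! ### Markov inequality -/

section markov

open Polynomial

/-- Among polynomials of degree at most $n$ bounded by 1 on $[-1,1]$, $T_n$ has the largest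
derivative at 1, namely $n\,U_{n-1}(1)=n^2$. -/
theorem eval_one_derivative_le {n : ℕ} {p : ℝ[X]} (hp : p.degree ≤ n) {B : ℝ} (hB : 0 < B)
    (hb : ∀ x ∈ Set.Icc (-1 : ℝ) 1, |p.eval x| ≤ B) :
    p.derivative.eval 1 ≤ (n : ℝ) ^ 2 * B := by
  have h := Chebyshev.eval_iterate_derivative_le_of_forall_abs_le_one (n := n) (P := C B⁻¹ * p)
    (k := 1) (x := 1) le_rfl (by
      rw [degree_C_mul (inv_ne_zero hB.ne')]; exact hp) (by
      intro x hx
      rw [eval_mul, eval_C, abs_mul, abs_of_pos (inv_pos.mpr hB), inv_mul_le_iff₀ hB, mul_one]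
      exact hb x hx)
  simp only [Function.iterate_one, derivative_C_mul, eval_mul, eval_C,
    Chebyshev.T_derivative_eq_U, Chebyshev.U_eval_one] at h
  rw [inv_mul_le_iff₀ hB] at h
  simp at h
  linarith

/-- The Markov inequality at an endpoint. -/
theorem abs_eval_one_derivative_le {n : ℕ} {p : ℝ[X]} (hp : p.degree ≤ n) {B : ℝ} (hB : 0 < B)
    (hb : ∀ x ∈ Set.Icc (-1 : ℝ) 1, |p.eval x| ≤ B) :
    |p.derivative.eval 1| ≤ (n : ℝ) ^ 2 * B := by
  refine abs_le'.mpr ⟨eval_one_derivative_le hp hB hb, ?_⟩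
  have := eval_one_derivative_le (p := -p) (by rwa [degree_neg]) hB (by simpa using hb)
  simpa using this

theorem degree_comp_linear_le {n : ℕ} {p : ℝ[X]} (hp : p.degree ≤ n) (a b : ℝ) :
    (p.comp (C a * X + C b)).degree ≤ n := by
  rw [← natDegree_le_iff_degree_le] at hp ⊢
  refine natDegree_comp_le.trans ?_
  calc p.natDegree * (C a * X + C b).natDegree ≤ n * 1 :=
        Nat.mul_le_mul hp (natDegree_linear_le)
    _ = n := mul_one n

/-- The affine map of $[-1,1]$ onto $[-1,x]$ sends 1 to $x$ and reduces to the endpoint case. Its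
slope $(x+1)/2\ge1/2$ accounts for the factor 2. -/
theorem abs_eval_derivative_le_of_nonneg {n : ℕ} {p : ℝ[X]} (hp : p.degree ≤ n) {B : ℝ}
    (hB : 0 < B) (hb : ∀ x ∈ Set.Icc (-1 : ℝ) 1, |p.eval x| ≤ B) {x : ℝ} (hx : 0 ≤ x)
    (hx1 : x ≤ 1) : |p.derivative.eval x| ≤ 2 * (n : ℝ) ^ 2 * B := by
  have h := abs_eval_one_derivative_le (degree_comp_linear_le hp ((x + 1) / 2) ((x - 1) / 2)) hB
    (fun t ht => by
      rw [eval_comp]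
      refine hb _ ?_
      simp only [eval_add, eval_mul, eval_C, eval_X]
      constructor <;> nlinarith [ht.1, ht.2])
  rw [derivative_comp, eval_mul, eval_comp] at h
  simp only [derivative_add, derivative_mul, derivative_C, derivative_X, zero_mul, mul_one,
    zero_add, add_zero, eval_add, eval_mul, eval_C, eval_X] at h
  rw [show (x + 1) / 2 + (x - 1) / 2 = x by ring, abs_mul,
    abs_of_nonneg (by linarith : 0 ≤ (x + 1) / 2)] at h
  nlinarith [abs_nonneg (p.derivative.eval x)]

/-- A weak form of the Markov inequality. -/
theorem abs_eval_derivative_le {n : ℕ} {p : ℝ[X]} (hp : p.degree ≤ n) {B : ℝ}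
    (hB : 0 < B) (hb : ∀ x ∈ Set.Icc (-1 : ℝ) 1, |p.eval x| ≤ B) {x : ℝ}
    (hx : x ∈ Set.Icc (-1 : ℝ) 1) : |p.derivative.eval x| ≤ 2 * (n : ℝ) ^ 2 * B := by
  rcases le_total 0 x with h | h
  · exact abs_eval_derivative_le_of_nonneg hp hB hb h hx.2
  · have h1 := abs_eval_derivative_le_of_nonneg (degree_comp_linear_le hp (-1) 0) hB
      (fun t ht => by
        rw [eval_comp]
        refine hb _ ?_
        simp only [eval_add, eval_mul, eval_C, eval_X]
        constructor <;> linarith [ht.1, ht.2]) (x := -x) (by linarith) (by linarith [hx.1])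
    rw [derivative_comp, eval_mul, eval_comp] at h1
    simpa using h1

theorem abs_eval_sub_eval_le {n : ℕ} {p : ℝ[X]} (hp : p.degree ≤ n) {B : ℝ}
    (hB : 0 < B) (hb : ∀ x ∈ Set.Icc (-1 : ℝ) 1, |p.eval x| ≤ B) {x y : ℝ}
    (hx : x ∈ Set.Icc (-1 : ℝ) 1) (hy : y ∈ Set.Icc (-1 : ℝ) 1) :
    |p.eval y - p.eval x| ≤ 2 * (n : ℝ) ^ 2 * B * |y - x| :=
  (convex_Icc (-1 : ℝ) 1).norm_image_sub_le_of_norm_hasDerivWithin_le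
    (f := fun x => p.eval x) (f' := fun x => p.derivative.eval x)
    (fun z _ => (p.hasDerivAt z).hasDerivWithinAt)
    (fun _ hz => abs_eval_derivative_le hp hB hb hz) hx hy

end markov

/-! ### Lower bound for the smallest singular value -/

theorem exists_card_le_abs_sub_le {N m : ℕ} (hm : m ≤ N + 1) {u : ℝ} (hu0 : 0 ≤ u) (hu : u ≤ N) :
    ∃ S : Finset (Fin (N + 1)), S.card = m ∧ ∀ k ∈ S, |((k : ℕ) : ℝ) - u| ≤ m := by
  -- A block of $m$ consecutive indices starting at $\lceil u\rceil$, shifted left when it would run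
  -- past $N$.
  set a := min ⌈u⌉₊ (N + 1 - m) with ha
  have hlt : ∀ i : Fin m, a + i < N + 1 := fun i => by
    have := min_le_right ⌈u⌉₊ (N + 1 - m)
    omega
  refine ⟨Finset.univ.image fun i : Fin m => ⟨a + i, hlt i⟩, ?_, ?_⟩
  · rw [Finset.card_image_of_injective, Finset.card_univ, Fintype.card_fin]
    intro i j h
    have := congrArg Fin.val h
    exact Fin.ext (by simpa using this)
  · intro k hk
    obtain ⟨i, -, rfl⟩ := Finset.mem_image.mp hk
    have hi : ((i : ℕ) : ℝ) + 1 ≤ m := by exact_mod_cast i.2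
    have hi0 : (0 : ℝ) ≤ (i : ℕ) := Nat.cast_nonneg _
    push_cast
    rcases le_or_gt ⌈u⌉₊ (N + 1 - m) with h | h
    · rw [min_eq_left h] at ha
      have h1 := Nat.le_ceil u
      have h2 := (Nat.ceil_lt_add_one hu0).le
      rw [ha, abs_le]
      constructor <;> linarith
    · rw [min_eq_right h.le] at ha
      have h1 := Nat.lt_ceil.mp h
      rw [Nat.cast_sub hm] at h1
      rw [ha, Nat.cast_sub hm, abs_le]
      push_cast at h1 ⊢
      constructor <;> linarith

theorem exists_abs_sub_le_half {N : ℕ} {u : ℝ} (hu0 : 0 ≤ u) (hu : u ≤ N) :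
    ∃ k : Fin (N + 1), |((k : ℕ) : ℝ) - u| ≤ 1 / 2 := by
  have h1 := Nat.floor_le (by linarith : 0 ≤ u + 1 / 2)
  have h2 := Nat.lt_floor_add_one (u + 1 / 2)
  refine ⟨⟨⌊u + 1 / 2⌋₊, ?_⟩, ?_⟩
  · rw [Nat.floor_lt (by linarith)]
    push_cast
    linarith
  · rw [abs_le]
    constructor <;> linarith

theorem mul_sq_le_sum_sq_equiPoint {N M : ℕ} (hM : 1 ≤ M) (hMN : 4 * M ^ 2 ≤ N) {p : ℝ[X]}
    (hp : p.degree ≤ M) {B : ℝ} (hB : 0 < B) (hb : ∀ x ∈ Set.Icc (-1 : ℝ) 1, |p.eval x| ≤ B)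
    {x : ℝ} (hx : x ∈ Set.Icc (-1 : ℝ) 1) (hxB : |p.eval x| = B) :
    2 * (N : ℝ) / (125 * (M : ℝ) ^ 2) * B ^ 2 ≤ ∑ k, p.eval (equiPoint N k) ^ 2 := by
  have hM0 : (0 : ℝ) < (M : ℝ) ^ 2 := by positivity
  have hMN' : 4 * (M : ℝ) ^ 2 ≤ N := by exact_mod_cast hMN
  have hN0 : (0 : ℝ) < N := by linarith
  set u := (x + 1) * N / 2 with hu
  have hu0 : 0 ≤ u := by have := hx.1; have : 0 ≤ x + 1 := by linarith
                         positivity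
  have huN : u ≤ N := by rw [hu]; nlinarith [hx.2]
  have hdist : ∀ k : Fin (N + 1), equiPoint N k - x = 2 / N * ((k : ℕ) - u) := fun k => by
    rw [equiPoint, hu]; field_simp; ring
  -- Moving $d$ grid steps, a distance $2d/N$, away from the maximum loses at most $2M^2B\cdot
  -- 2d/N$.
  have hval : ∀ (k : Fin (N + 1)) (d : ℝ), |((k : ℕ) : ℝ) - u| ≤ d →
      B * (1 - 4 * (M : ℝ) ^ 2 / N * d) ≤ |p.eval (equiPoint N k)| := fun k d hd => by
    have h1 := abs_eval_sub_eval_le hp hB hb hx (equiPoint_mem_Icc N k)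
    rw [hdist, abs_mul, abs_of_pos (by positivity : (0 : ℝ) < 2 / N)] at h1
    have h2 : 2 * (M : ℝ) ^ 2 * B * (2 / N * |((k : ℕ) : ℝ) - u|) ≤
        2 * (M : ℝ) ^ 2 * B * (2 / N * d) := by gcongr
    have h3 := abs_sub_abs_le_abs_sub (p.eval x) (p.eval (equiPoint N k))
    rw [abs_sub_comm, hxB] at h3
    have h4 : B * (1 - 4 * (M : ℝ) ^ 2 / N * d) = B - 2 * (M : ℝ) ^ 2 * B * (2 / N * d) := by ring
    rw [h4]
    linarith
  -- For $N\le12M^2$ the nearest grid point, with value at least $B/2$, suffices. Otherwise about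
  -- $N/(12M^2)$ neighbours all keep at least $2B/3$.
  rcases le_total (N : ℝ) (12 * (M : ℝ) ^ 2) with h | h
  · obtain ⟨k, hk⟩ := exists_abs_sub_le_half hu0 huN
    have h1 := hval k _ hk
    have h2 : 4 * (M : ℝ) ^ 2 / N ≤ 1 := by rw [div_le_one hN0]; exact hMN'
    have h3 : B / 2 ≤ |p.eval (equiPoint N k)| := by nlinarith
    have h4 : (B / 2) ^ 2 ≤ p.eval (equiPoint N k) ^ 2 := by
      rw [← sq_abs (p.eval _)]
      exact pow_le_pow_left₀ (by positivity) h3 2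
    have h5 := Finset.single_le_sum (f := fun k => p.eval (equiPoint N k) ^ 2)
      (fun k _ => sq_nonneg _) (Finset.mem_univ k)
    have h6 : 2 * (N : ℝ) / (125 * (M : ℝ) ^ 2) ≤ 1 / 4 := by
      rw [div_le_iff₀ (by positivity)]
      linarith
    calc _ ≤ 1 / 4 * B ^ 2 := by gcongr
      _ = (B / 2) ^ 2 := by ring
      _ ≤ _ := h4.trans h5
  · set m := ⌊(N : ℝ) / (12 * (M : ℝ) ^ 2)⌋₊ with hm
    have h1 : 1 ≤ (N : ℝ) / (12 * (M : ℝ) ^ 2) := by rwa [one_le_div (by positivity)]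
    have h2 : (m : ℝ) ≤ (N : ℝ) / (12 * (M : ℝ) ^ 2) := Nat.floor_le (by positivity)
    have h3 : (N : ℝ) / (12 * (M : ℝ) ^ 2) < m + 1 := Nat.lt_floor_add_one _
    have h4 : (1 : ℝ) ≤ m := Nat.one_le_cast.mpr ((Nat.one_le_floor_iff _).mpr h1)
    have h5 : m ≤ N + 1 := by
      have : (m : ℝ) ≤ N := h2.trans (div_le_self hN0.le (by
        have : (1 : ℝ) ≤ (M : ℝ) ^ 2 := by exact_mod_cast Nat.one_le_pow _ _ hM
        linarith))
      exact (by exact_mod_cast this : m ≤ N).trans (Nat.le_succ N)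
    obtain ⟨S, hS, hSk⟩ := exists_card_le_abs_sub_le h5 hu0 huN
    have h6 : ∀ k ∈ S, (2 / 3 * B) ^ 2 ≤ p.eval (equiPoint N k) ^ 2 := fun k hk => by
      have h7 := hval k _ (hSk k hk)
      have h8 : 4 * (M : ℝ) ^ 2 / N * m ≤ 1 / 3 := by
        calc _ ≤ 4 * (M : ℝ) ^ 2 / N * ((N : ℝ) / (12 * (M : ℝ) ^ 2)) := by gcongr
          _ = 1 / 3 := by field_simp; norm_num
      rw [← sq_abs (p.eval _)]
      refine pow_le_pow_left₀ (by positivity) ?_ 2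
      nlinarith
    have h7 := Finset.card_nsmul_le_sum S _ _ h6
    rw [hS, nsmul_eq_mul] at h7
    have h8 : ∑ k ∈ S, p.eval (equiPoint N k) ^ 2 ≤ ∑ k, p.eval (equiPoint N k) ^ 2 :=
      Finset.sum_le_sum_of_subset_of_nonneg (Finset.subset_univ S) fun _ _ _ => sq_nonneg _
    refine le_trans ?_ (h7.trans h8)
    have h9 : 2 * (N : ℝ) / (125 * (M : ℝ) ^ 2) =
        24 / 125 * ((N : ℝ) / (12 * (M : ℝ) ^ 2)) := by field_simp; norm_num
    rw [h9]
    -- Since $m\ge1$, the quotient is below $m+1\le2m$, and $48/125<4/9$.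
    have h10 : 24 / 125 * ((N : ℝ) / (12 * (M : ℝ) ^ 2)) ≤ m * (4 / 9) := by linarith
    calc _ ≤ m * (4 / 9) * B ^ 2 := by gcongr
      _ = _ := by ring

/-- The $T_j$ are orthogonal for the Chebyshev weight, with squared norm $\pi$ for $j=0$ and $\pi/2$
otherwise. -/
theorem pi_div_two_mul_norm_sq_le (M : ℕ) (c : EuclideanSpace ℝ (Fin (M + 1))) :
    Real.pi / 2 * ‖c‖ ^ 2 ≤ ∫ x, (∑ j, c j *
      (Polynomial.Chebyshev.T ℝ ((j : ℕ) : ℤ)).eval x) ^ 2 ∂Polynomial.Chebyshev.measureT := by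
  have hint : ∀ i j : Fin (M + 1), Integrable (fun x => c i * c j *
      ((Polynomial.Chebyshev.T ℝ ((i : ℕ) : ℤ)).eval x *
        (Polynomial.Chebyshev.T ℝ ((j : ℕ) : ℤ)).eval x)) Polynomial.Chebyshev.measureT :=
    fun i j => Polynomial.Chebyshev.integrable_measureT (by fun_prop)
  have h1 : ∀ x, (∑ j, c j * (Polynomial.Chebyshev.T ℝ ((j : ℕ) : ℤ)).eval x) ^ 2 =
      ∑ i, ∑ j, c i * c j * ((Polynomial.Chebyshev.T ℝ ((i : ℕ) : ℤ)).eval x *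
        (Polynomial.Chebyshev.T ℝ ((j : ℕ) : ℤ)).eval x) := fun x => by
    rw [sq, Finset.sum_mul_sum]
    refine Finset.sum_congr rfl fun i _ => Finset.sum_congr rfl fun j _ => by ring
  simp_rw [h1]
  rw [integral_finsetSum _ fun i _ => integrable_finsetSum _ fun j _ => hint i j,
    EuclideanSpace.real_norm_sq_eq, Finset.mul_sum]
  refine Finset.sum_le_sum fun i _ => ?_
  rw [integral_finsetSum _ fun j _ => hint i j, Finset.sum_eq_single i]
  · rw [integral_const_mul]
    by_cases hi : (i : ℕ) = 0
    · rw [hi, Nat.cast_zero, Polynomial.Chebyshev.integral_eval_T_real_mul_self_measureT_zero]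
      nlinarith [Real.pi_pos, sq_nonneg (c i)]
    · rw [Polynomial.Chebyshev.integral_T_real_mul_self_measureT_of_ne_zero hi]
      exact le_of_eq (by ring)
  · intro j _ hj
    rw [integral_const_mul,
      Polynomial.Chebyshev.integral_eval_T_real_mul_eval_T_real_measureT_of_ne
        (fun h => hj (Fin.ext h.symm)), mul_zero]
  · simp

theorem norm_sq_le_two_mul_sq {M : ℕ} {c : EuclideanSpace ℝ (Fin (M + 1))} {B : ℝ}
    (hb : ∀ x ∈ Set.Icc (-1 : ℝ) 1,
      |∑ j, c j * (Polynomial.Chebyshev.T ℝ ((j : ℕ) : ℤ)).eval x| ≤ B) :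
    ‖c‖ ^ 2 ≤ 2 * B ^ 2 := by
  have h1 := pi_div_two_mul_norm_sq_le M c
  rw [Polynomial.Chebyshev.integral_measureT_eq_integral_cos] at h1
  have h2 : ∫ θ in (0 : ℝ)..Real.pi, (∑ j, c j *
      (Polynomial.Chebyshev.T ℝ ((j : ℕ) : ℤ)).eval (Real.cos θ)) ^ 2 ≤
      ∫ _ in (0 : ℝ)..Real.pi, B ^ 2 := by
    refine intervalIntegral.integral_mono_on Real.pi_pos.le
      (Continuous.intervalIntegrable (by fun_prop) _ _)
      (Continuous.intervalIntegrable (by fun_prop) _ _) fun θ _ => ?_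
    rw [← sq_abs]
    exact pow_le_pow_left₀ (abs_nonneg _) (hb _ (Real.cos_mem_Icc θ)) 2
  rw [intervalIntegral.integral_const, smul_eq_mul, sub_zero] at h2
  have h3 : Real.pi * (‖c‖ ^ 2) ≤ Real.pi * (2 * B ^ 2) := by linarith
  exact le_of_mul_le_mul_left h3 Real.pi_pos

theorem mul_norm_sq_le_norm_sq_chebVandermonde {N M : ℕ} (hMN : 4 * M ^ 2 ≤ N)
    (c : EuclideanSpace ℝ (Fin (M + 1))) :
    (N : ℝ) / (125 * ((M : ℝ) + 1) ^ 2) * ‖c‖ ^ 2 ≤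
      ‖Matrix.toEuclideanLin (chebVandermonde N M) c‖ ^ 2 := by
  rw [EuclideanSpace.real_norm_sq_eq (Matrix.toEuclideanLin (chebVandermonde N M) c)]
  simp_rw [toEuclideanLin_chebVandermonde_apply]
  -- For $M=0$ the matrix is a column of ones. The grid estimate needs $M\ge1$; having $M+1$ in the
  -- denominator covers both cases.
  rcases Nat.eq_zero_or_pos M with rfl | hM
  · rw [EuclideanSpace.real_norm_sq_eq]
    simp
    nlinarith [sq_nonneg (c 0), (Nat.cast_nonneg N : (0 : ℝ) ≤ N),
      mul_nonneg (Nat.cast_nonneg N : (0 : ℝ) ≤ N) (sq_nonneg (c 0))]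
  set p : ℝ[X] := ∑ j, c j • Polynomial.Chebyshev.T ℝ ((j : Fin (M + 1)) : ℤ) with hp
  have heval : ∀ x : ℝ, p.eval x =
      ∑ j, c j * (Polynomial.Chebyshev.T ℝ ((j : ℕ) : ℤ)).eval x := fun x => by
    simp [hp, Polynomial.eval_finsetSum]
  have hdeg : p.degree ≤ M := by
    rw [← Polynomial.mem_degreeLE]
    refine Submodule.sum_mem _ fun j _ => Submodule.smul_mem _ _ ?_
    rw [Polynomial.mem_degreeLE, Polynomial.Chebyshev.degree_T]
    exact_mod_cast Nat.lt_succ_iff.mp j.2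
  simp_rw [← heval]
  obtain ⟨x, hx, hmax⟩ := (isCompact_Icc (a := (-1 : ℝ)) (b := 1)).exists_isMaxOn
    ⟨0, by simp⟩ (f := fun x => |p.eval x|) (by fun_prop)
  have hb : ∀ y ∈ Set.Icc (-1 : ℝ) 1, |p.eval y| ≤ |p.eval x| := fun y hy => hmax hy
  have hc : ‖c‖ ^ 2 ≤ 2 * |p.eval x| ^ 2 := norm_sq_le_two_mul_sq fun y hy => by
    rw [← heval]; exact hb y hy
  have hM' : (0 : ℝ) < M := by exact_mod_cast hM
  rcases (abs_nonneg (p.eval x)).eq_or_lt with h0 | h0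
  · rw [← h0] at hc
    have : ‖c‖ ^ 2 = 0 := le_antisymm (by simpa using hc) (sq_nonneg _)
    rw [this, mul_zero]
    exact Finset.sum_nonneg fun _ _ => sq_nonneg _
  · refine le_trans ?_ (mul_sq_le_sum_sq_equiPoint hM hMN hdeg h0 hb hx rfl)
    calc (N : ℝ) / (125 * ((M : ℝ) + 1) ^ 2) * ‖c‖ ^ 2
        ≤ (N : ℝ) / (125 * (M : ℝ) ^ 2) * (2 * |p.eval x| ^ 2) := by
          gcongr
          linarith
      _ = _ := by ring

theorem sqrt_div_le_sigmaMin {N M : ℕ} (hMN : 4 * M ^ 2 ≤ N) :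
    √(N : ℝ) / (5 * √5 * ((M : ℝ) + 1)) ≤ sigmaMin N M := by
  obtain ⟨v, hv, h⟩ := exists_norm_eq_sigmaMin_mul N M
  have h1 := mul_norm_sq_le_norm_sq_chebVandermonde hMN v
  rw [h, mul_pow] at h1
  have h2 := le_of_mul_le_mul_right h1 (by positivity)
  refine le_of_sq_le_sq (le_trans (le_of_eq ?_) h2) (LinearMap.singularValues_nonneg _ _)
  rw [div_pow, mul_pow, mul_pow, Real.sq_sqrt (Nat.cast_nonneg N), Real.sq_sqrt (by norm_num)]
  norm_num

/-! ### Rows of the solution operator -/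

theorem fitCoeff_apply (N M : ℕ) (y : EuclideanSpace ℂ (Fin (N + 1))) (j : Fin (M + 1)) :
    fitCoeff N M y j = ∑ k, y k * fitCoeff N M (EuclideanSpace.single k 1) j := by
  have h : y = ∑ k, y k • EuclideanSpace.single k (1 : ℂ) := by
    ext i
    simp [Finset.sum_apply, Pi.single_apply]
  conv_lhs => rw [h, map_sum]
  simp

/-- Duality: for the conjugate of the row $a$ as data, coefficient $j$ equals $\|a\|^2$, so the
operator bound gives $\|a\|^2\le\|a\|/\sigma$. -/
theorem sqrt_sum_norm_sq_fitCoeff_le {N M : ℕ} (hN : 1 ≤ N) (hMN : M ≤ N) (j : Fin (M + 1)) :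
    √(∑ k, ‖fitCoeff N M (EuclideanSpace.single k 1) j‖ ^ 2) ≤ 1 / sigmaMin N M := by
  set a := fun k => fitCoeff N M (EuclideanSpace.single k 1) j with ha
  set y : EuclideanSpace ℂ (Fin (N + 1)) := WithLp.toLp 2 fun k => (starRingEnd ℂ) (a k) with hy
  have hnorm : ‖y‖ = √(∑ k, ‖a k‖ ^ 2) := by
    rw [EuclideanSpace.norm_eq]
    simp [hy]
  have hyj : fitCoeff N M y j = ((∑ k, ‖a k‖ ^ 2 : ℝ) : ℂ) := by
    rw [fitCoeff_apply]
    push_cast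
    refine Finset.sum_congr rfl fun k _ => ?_
    exact Complex.conj_mul' (a k)
  have h1 : ∑ k, ‖a k‖ ^ 2 ≤ ‖y‖ / sigmaMin N M := by
    calc ∑ k, ‖a k‖ ^ 2 = ‖fitCoeff N M y j‖ := by
          rw [hyj, Complex.norm_real, Real.norm_of_nonneg (by positivity)]
      _ ≤ ‖fitCoeff N M y‖ := PiLp.norm_apply_le _ _
      _ ≤ _ := norm_fitCoeff_le hN hMN y
  rw [hnorm] at h1
  set R := ∑ k, ‖a k‖ ^ 2
  have hR : 0 ≤ R := by positivity
  have hs := sigmaMin_pos hN hMN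
  change √R ≤ _
  rcases (Real.sqrt_nonneg R).eq_or_lt with h | h
  · rw [← h]; positivity
  · refine le_of_mul_le_mul_left ?_ h
    rw [Real.mul_self_sqrt hR, mul_one_div]
    exact h1

/-! ### Uniform error of the fit -/

section error

variable {N M : ℕ} {ρ Q : ℝ} {f : ℝ → ℂ}

/-- Needed because a real supremum over an unbounded set defaults to 0, so values lie below it only
once boundedness is known. -/
theorem bddAbove_norm_sub_chebPoly (hρ : 1 < ρ) (hf : f ∈ BernsteinClass ρ Q)
    (c : EuclideanSpace ℂ (Fin (M + 1))) :
    BddAbove (Set.range fun x : Set.Icc (-1 : ℝ) 1 =>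
      ‖f (x : ℝ) - (chebPoly M c).eval ((x : ℝ) : ℂ)‖) := by
  obtain ⟨q, hq, hqf⟩ := exists_norm_sub_eval_le hρ hf M
  rw [← range_chebPoly] at hq
  obtain ⟨d, rfl⟩ := hq
  refine ⟨2 * Q * (ρ ^ (-(M : ℤ)) / (ρ - 1)) + ∑ j, ‖(d - c) j‖, ?_⟩
  rintro _ ⟨x, rfl⟩
  have h : f (x : ℝ) - (chebPoly M c).eval ((x : ℝ) : ℂ) =
      (f (x : ℝ) - (chebPoly M d).eval ((x : ℝ) : ℂ)) +
        (chebPoly M (d - c)).eval ((x : ℝ) : ℂ) := by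
    rw [map_sub, Polynomial.eval_sub]; ring
  change ‖f (x : ℝ) - (chebPoly M c).eval ((x : ℝ) : ℂ)‖ ≤ _
  rw [h]
  exact (norm_add_le _ _).trans (add_le_add (hqf x x.2) (norm_chebPoly_eval_le M _ x.2))

theorem uniformError_chebPoly_le_add (hρ : 1 < ρ) (hf : f ∈ BernsteinClass ρ Q)
    (c d : EuclideanSpace ℂ (Fin (M + 1))) :
    uniformError f (chebPoly M c) ≤ uniformError f (chebPoly M d) + ∑ j, ‖(d - c) j‖ := by
  have : Nonempty (Set.Icc (-1 : ℝ) 1) := ⟨⟨0, by simp⟩⟩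
  refine ciSup_le fun x => ?_
  have h : f (x : ℝ) - (chebPoly M c).eval ((x : ℝ) : ℂ) =
      (f (x : ℝ) - (chebPoly M d).eval ((x : ℝ) : ℂ)) +
        (chebPoly M (d - c)).eval ((x : ℝ) : ℂ) := by
    rw [map_sub, Polynomial.eval_sub]; ring
  rw [h]
  exact (norm_add_le _ _).trans (add_le_add
    (le_ciSup (bddAbove_norm_sub_chebPoly hρ hf d) x) (norm_chebPoly_eval_le M _ x.2))

/-- This supplies measurability of the random error. -/
theorem continuous_uniformError_chebPoly (hρ : 1 < ρ) (hf : f ∈ BernsteinClass ρ Q) :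
    Continuous fun c : EuclideanSpace ℂ (Fin (M + 1)) => uniformError f (chebPoly M c) := by
  refine (LipschitzWith.of_le_add_mul (NNReal.sqrt ((M + 1 : ℕ) : ℝ≥0)) fun c d => ?_).continuous
  refine (uniformError_chebPoly_le_add hρ hf c d).trans (add_le_add_right ?_ _)
  rw [dist_comm, dist_eq_norm]
  simpa using sum_norm_le_sqrt_mul_norm (d - c)

/-- The fit reproduces the near-best polynomial $d$, so its deviation from $d$ is the fit to grid
data of size at most $B$ per point. -/
theorem uniformError_fitCoeff_le (hN : 1 ≤ N) (hMN : M ≤ N) (hρ : 1 < ρ)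
    (hf : f ∈ BernsteinClass ρ Q) :
    uniformError f (chebPoly M (fitCoeff N M (WithLp.toLp 2 fun k => f (equiPoint N k)))) ≤
      2 * Q * (ρ ^ (-(M : ℤ)) / (ρ - 1)) *
        (1 + √((M : ℝ) + 1) * √((N : ℝ) + 1) / sigmaMin N M) := by
  obtain ⟨q, hq, hqf⟩ := exists_norm_sub_eval_le hρ hf M
  rw [← range_chebPoly] at hq
  obtain ⟨d, rfl⟩ := hq
  set B := 2 * Q * (ρ ^ (-(M : ℤ)) / (ρ - 1)) with hB
  have hs := sigmaMin_pos hN hMN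
  have hB0 : 0 ≤ B := (norm_nonneg _).trans (hqf 0 (by simp))
  set y : EuclideanSpace ℂ (Fin (N + 1)) := WithLp.toLp 2 fun k => f (equiPoint N k) with hy
  have : Nonempty (Set.Icc (-1 : ℝ) 1) := ⟨⟨0, by simp⟩⟩
  have h1 : uniformError f (chebPoly M d) ≤ B := ciSup_le fun x => hqf x x.2
  have h2 : ‖chebGrid N M d - y‖ ≤ √((N : ℝ) + 1) * B := by
    have h3 : ∀ k, ‖(chebGrid N M d - y) k‖ ≤ B := fun k => by
      rw [← norm_neg]
      simpa [hy, chebGrid, gridEval_apply] using hqf _ (equiPoint_mem_Icc N k)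
    rw [EuclideanSpace.norm_eq]
    refine (Real.sqrt_le_sqrt (Finset.sum_le_sum fun k _ =>
      pow_le_pow_left₀ (norm_nonneg _) (h3 k) 2)).trans (le_of_eq ?_)
    rw [Finset.sum_const, Finset.card_univ, Fintype.card_fin, nsmul_eq_mul,
      Real.sqrt_mul (by positivity), Real.sqrt_sq hB0]
    push_cast
    rfl
  have h4 : ∑ j, ‖(d - fitCoeff N M y) j‖ ≤
      √((M : ℝ) + 1) * (√((N : ℝ) + 1) * B / sigmaMin N M) := by
    refine (sum_norm_le_sqrt_mul_norm _).trans ?_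
    push_cast
    refine mul_le_mul_of_nonneg_left ?_ (Real.sqrt_nonneg _)
    conv_lhs => rw [← fitCoeff_chebGrid hN hMN d, ← map_sub]
    exact (norm_fitCoeff_le hN hMN _).trans (by gcongr)
  refine (uniformError_chebPoly_le_add hρ hf _ d).trans ((add_le_add h1 h4).trans (le_of_eq ?_))
  ring

theorem integrable_uniformError_and_integral_le {Ω : Type*} [MeasurableSpace Ω] {P : Measure Ω}
    [IsProbabilityMeasure P] (hN : 1 ≤ N) (hMN : M ≤ N) (hρ : 1 < ρ) (hf : f ∈ BernsteinClass ρ Q)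
    {s : ℝ≥0} {ε : Fin (N + 1) → Ω → ℝ}
    (hlaw : ∀ k, HasLaw (ε k) (gaussianReal 0 (s ^ 2)) P) (hindep : iIndepFun ε P)
    {p : Ω → ℂ[X]}
    (hp : ∀ ω, IsLeastSquaresFit N M (fun k => f (equiPoint N k) + (ε k ω : ℂ)) (p ω)) :
    Integrable (fun ω => uniformError f (p ω)) P ∧
      ∫ ω, uniformError f (p ω) ∂P ≤ ((M : ℝ) + 1) * (s / sigmaMin N M) +
        2 * Q * (ρ ^ (-(M : ℤ)) / (ρ - 1)) *
          (1 + √((M : ℝ) + 1) * √((N : ℝ) + 1) / sigmaMin N M) := by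
  set K := 2 * Q * (ρ ^ (-(M : ℤ)) / (ρ - 1)) *
    (1 + √((M : ℝ) + 1) * √((N : ℝ) + 1) / sigmaMin N M) with hK
  set y : EuclideanSpace ℂ (Fin (N + 1)) := WithLp.toLp 2 fun k => f (equiPoint N k) with hy
  set e : Ω → EuclideanSpace ℂ (Fin (N + 1)) := fun ω => WithLp.toLp 2 fun k => (ε k ω : ℂ) with he
  -- Uniqueness identifies the arbitrary selection `p` with an explicit continuous function of the
  -- noise, so its error is measurable without further assumption.
  have hpe : ∀ ω, p ω = chebPoly M (fitCoeff N M (y + e ω)) := fun ω => by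
    rw [(isLeastSquaresFit_iff hN hMN _ _).mp (hp ω)]
    rfl
  have hej : ∀ ω j, fitCoeff N M (e ω) j =
      ∑ k, (ε k ω : ℂ) * fitCoeff N M (EuclideanSpace.single k 1) j := fun ω j =>
    fitCoeff_apply N M (e ω) j
  have hle : ∀ ω, uniformError f (p ω) ≤ ∑ j, ‖fitCoeff N M (e ω) j‖ + K := fun ω => by
    rw [hpe, add_comm (∑ j, _) K]
    refine (uniformError_chebPoly_le_add hρ hf _ (fitCoeff N M y)).trans
      (add_le_add (uniformError_fitCoeff_le hN hMN hρ hf) (le_of_eq ?_))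
    refine Finset.sum_congr rfl fun j _ => ?_
    rw [map_add, sub_add_cancel_left, PiLp.neg_apply, norm_neg]
  have hnonneg : ∀ ω, 0 ≤ uniformError f (p ω) := fun ω =>
    Real.iSup_nonneg fun _ => norm_nonneg _
  have hgauss := fun j => integral_norm_sum_gaussian_le hlaw hindep
    fun k => fitCoeff N M (EuclideanSpace.single k 1) j
  have hint : Integrable (fun ω => ∑ j, ‖fitCoeff N M (e ω) j‖ + K) P := by
    simp_rw [hej]
    exact (integrable_finsetSum _ fun j _ => (hgauss j).1).add (integrable_const K)
  have hmeas : AEStronglyMeasurable (fun ω => uniformError f (p ω)) P := by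
    have hem : AEMeasurable e P :=
      (WithLp.measurable_toLp 2 _).comp_aemeasurable (aemeasurable_pi_lambda _ fun k =>
        Complex.measurable_ofReal.comp_aemeasurable (hlaw k).aemeasurable)
    have hc : Continuous fun z => uniformError f (chebPoly M (fitCoeff N M (y + z))) :=
      (continuous_uniformError_chebPoly hρ hf).comp
        ((LinearMap.continuous_of_finiteDimensional (fitCoeff N M)).comp (continuous_const_add y))
    have := (hc.measurable.comp_aemeasurable hem).aestronglyMeasurable
    refine this.congr (Filter.Eventually.of_forall fun ω => ?_)
    simp only [Function.comp_apply, hpe]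
  have hint' : Integrable (fun ω => uniformError f (p ω)) P :=
    hint.mono' hmeas (Filter.Eventually.of_forall fun ω => by
      rw [Real.norm_of_nonneg (hnonneg ω)]; exact hle ω)
  refine ⟨hint', (integral_mono hint' hint hle).trans ?_⟩
  simp_rw [hej]
  rw [integral_add (integrable_finsetSum _ fun j _ => (hgauss j).1) (integrable_const K),
    integral_finsetSum _ fun j _ => (hgauss j).1, integral_const]
  simp only [probReal_univ, one_smul]
  refine add_le_add_left ?_ _
  have h1 : ∀ j : Fin (M + 1), ∫ ω, ‖∑ k, (ε k ω : ℂ) *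
      fitCoeff N M (EuclideanSpace.single k 1) j‖ ∂P ≤ s / sigmaMin N M := fun j => by
    refine (hgauss j).2.trans ?_
    rw [div_eq_mul_one_div]
    exact mul_le_mul_of_nonneg_left (sqrt_sum_norm_sq_fitCoeff_le hN hMN j) s.2
  refine (Finset.sum_le_sum fun j _ => h1 j).trans (le_of_eq ?_)
  simp

end error

end EquispacedLeastSquares

end

/-! ### The two expectation bounds -/

open EquispacedLeastSquares in
theorem corollary5p2 {Ω : Type*} [MeasurableSpace Ω] (P : Measure Ω) [IsProbabilityMeasure P]
    (N M : ℕ) (hN : 1 ≤ N) (hMN : M ≤ N)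
    (ρ Q : ℝ) (hρ : 1 < ρ) (f : ℝ → ℂ) (hf : f ∈ BernsteinClass ρ Q)
    (s : ℝ≥0) (ε : Fin (N + 1) → Ω → ℝ)
    (hlaw : ∀ k, HasLaw (ε k) (gaussianReal 0 (s ^ 2)) P) (hindep : iIndepFun ε P) :
    (∀ y : Fin (N + 1) → ℂ, ∃! p : ℂ[X], IsLeastSquaresFit N M y p) ∧
    ∀ p : Ω → ℂ[X],
      (∀ ω, IsLeastSquaresFit N M (fun k => f (equiPoint N k) + (ε k ω : ℂ)) (p ω)) →
      Integrable (fun ω => uniformError f (p ω)) P ∧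
      ∫ ω, uniformError f (p ω) ∂P ≤
        ((M : ℝ) + 1) ^ (3 / 2 : ℝ) * (s : ℝ) / matrixSingularValue (chebVandermonde N M) (M + 1)
          + 2 * Q * (1 + ((M : ℝ) + 1) * √((N : ℝ) + 1)
              / matrixSingularValue (chebVandermonde N M) (M + 1)) * (ρ ^ (-(M : ℤ)) / (ρ - 1)) ∧
      ((M : ℝ) ≤ √(N : ℝ) / 2 →
        ∫ ω, uniformError f (p ω) ∂P ≤
          5 * √5 * ((M : ℝ) + 1) ^ 2 * (s : ℝ) / √(N : ℝ)
            + 2 * Q * (1 + 10 * √5 * ((M : ℝ) + 1) ^ (3 / 2 : ℝ))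
              * (ρ ^ (-(M : ℤ)) / (ρ - 1))) := by
  refine ⟨fun y => ⟨_, (isLeastSquaresFit_iff hN hMN y _).mpr rfl,
    fun p hp => (isLeastSquaresFit_iff hN hMN y p).mp hp⟩, fun p hp => ?_⟩
  obtain ⟨hint, hle⟩ := integrable_uniformError_and_integral_le hN hMN hρ hf hlaw hindep hp
  have hs := sigmaMin_pos hN hMN
  have hQ := bound_nonneg_of_mem_bernsteinClass hρ hf
  have hτ : 0 ≤ ρ ^ (-(M : ℤ)) / (ρ - 1) :=
    div_nonneg (zpow_nonneg (by linarith) _) (by linarith)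
  have hM1 : (1 : ℝ) ≤ (M : ℝ) + 1 := by
    have : (0 : ℝ) ≤ M := Nat.cast_nonneg M
    linarith
  have hsq1 : 1 ≤ √((M : ℝ) + 1) := Real.one_le_sqrt.mpr hM1
  have hpow : ((M : ℝ) + 1) ^ (3 / 2 : ℝ) = ((M : ℝ) + 1) * √((M : ℝ) + 1) := by
    rw [Real.sqrt_eq_rpow, show (3 / 2 : ℝ) = 1 + 1 / 2 by norm_num,
      Real.rpow_add (by linarith), Real.rpow_one]
  refine ⟨hint, hle.trans ?_, fun hMs => hle.trans ?_⟩
  -- The bound in `hle` is sharper: it has $M+1$ and $\sqrt{M+1}$ where the claim allows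
  -- $(M+1)^{3/2}$ and $M+1$.
  · refine add_le_add ?_ ?_
    · rw [hpow, mul_div_assoc]
      gcongr
      exact le_mul_of_one_le_right (by linarith) hsq1
    · rw [mul_right_comm (2 * Q)]
      gcongr
      rw [Real.sqrt_le_left (by linarith)]
      nlinarith
  · have hN0 : (0 : ℝ) < N := by exact_mod_cast hN
    have hMN4 : 4 * M ^ 2 ≤ N := by
      have h1 : (2 * (M : ℝ)) ^ 2 ≤ √(N : ℝ) ^ 2 :=
        pow_le_pow_left₀ (by positivity) (by linarith) 2
      rw [Real.sq_sqrt hN0.le] at h1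
      have h2 : 4 * (M : ℝ) ^ 2 ≤ N := by linarith
      exact_mod_cast h2
    have hNs : 0 < √(N : ℝ) := Real.sqrt_pos.mpr hN0
    have hσ : 1 / sigmaMin N M ≤ 5 * √5 * ((M : ℝ) + 1) / √(N : ℝ) := by
      rw [one_div, ← inv_div (√(N : ℝ))]
      exact inv_anti₀ (by positivity) (sqrt_div_le_sigmaMin hMN4)
    -- This crude factor 2 turns $5\sqrt5$ into $10\sqrt5$.
    have hN1 : √((N : ℝ) + 1) ≤ 2 * √(N : ℝ) := by
      rw [Real.sqrt_le_left (by positivity), mul_pow, Real.sq_sqrt hN0.le]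
      have : (1 : ℝ) ≤ N := by exact_mod_cast hN
      linarith
    refine add_le_add ?_ ?_
    · calc ((M : ℝ) + 1) * (s / sigmaMin N M)
          = ((M : ℝ) + 1) * s * (1 / sigmaMin N M) := by ring
        _ ≤ ((M : ℝ) + 1) * s * (5 * √5 * ((M : ℝ) + 1) / √(N : ℝ)) := by gcongr
        _ = _ := by ring
    · rw [mul_right_comm (2 * Q), hpow]
      have h3 : √((M : ℝ) + 1) * √((N : ℝ) + 1) / sigmaMin N M ≤
          10 * √5 * (((M : ℝ) + 1) * √((M : ℝ) + 1)) := by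
        calc √((M : ℝ) + 1) * √((N : ℝ) + 1) / sigmaMin N M
            = √((M : ℝ) + 1) * √((N : ℝ) + 1) * (1 / sigmaMin N M) := by ring
          _ ≤ √((M : ℝ) + 1) * (2 * √(N : ℝ)) *
              (5 * √5 * ((M : ℝ) + 1) / √(N : ℝ)) := by gcongr
          _ = _ := by field_simp; ring
      gcongr
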